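/- Let $n\ge 3$, $m\ge 1$ be integers, let $r>0$, let $\varepsilon_1,\dots,\varepsilon_n\in\{1,-1\}$, and let $g=\sum_i\varepsilon_i\,dx_i^2$ be the pseudo-Euclidean metric on $\mathbb{R}^n$. Let $\alpha\in\mathbb{R}^n$ satisfy $\sum_{i}\varepsilon_i\alpha_i^2=0$, put $\xi=\sum_i\alpha_ix_i$, and let $(F^m,g_F)$ be a Ricci-flat semi-Riemannian manifold of dimension $m$. A semi-Riemannian manifold $(M,\widetilde g)$ with a smooth nowhere vanishing function $h$ is called quasi-Einstein (with constants $r$ and $\rho\in\mathbb{R}$) if $$\mathrm{Ric}_{\widetilde g}-\frac{r}{h}\,\mathrm{Hess}_{\widetilde g}h=\rho\,\widetilde g .$$ (1) Let $J\subseteq\mathbb{R}$ be open, let $f,\varphi:J\to(0,\infty)$ be arbitrary smooth positive functions, and let $h:J\to\mathbb{R}$ be any twice differentiable solution of the linear ordinary differential equation $$-rf\varphi h''-2rf\varphi'h'+\big[(n-2)f\varphi''-m\varphi f''-2m\varphi'f'\big]h=0\quad\text{on }J .$$ Then the warped product metric $\widetilde g=\frac{1}{\varphi(\xi)^2}\,g+f(\xi)^2g_F$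 is a semi-Riemannian metric on $M=\{x\in\mathbb{R}^n:\xi\in J,\ h(\xi)\neq0\}\times F$, the function $h(\xi)$ is smooth on $M$, and $(M,\widetilde g,h(\xi))$ is quasi-Einstein with $\rho=0$. (For $J=\mathbb{R}$ and $h$ without zeros, $M=\mathbb{R}^n\times F$.) (2) In particular, if $\alpha\neq0$, there are infinitely many such solutions on the whole of $\mathbb{R}^n\times F$: there are infinitely many triples $(f,\varphi,h)$ of smooth positive functions on $\mathbb{R}$, even with the normalization $f(0)=\varphi(0)=h(0)=1$, such that $\big(\mathbb{R}^n\times F,\ \frac{1}{\varphi(\xi)^2}g+f(\xi)^2g_F,\ h(\xi)\big)$ is quasi-Einstein with $\rho=0$. -/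

import Mathlib

open Set Module
open scoped Manifold ContDiff

set_option maxSynthPendingDepth 3

noncomputable section

section Local

variable {E : Type*} [NormedAddCommGroup E] [NormedSpace ℝ E]

/-- For a field `G` of bilinear forms on a vector space `E`, the trilinear form
`(v, w, u) ↦ (1/2) (∂_v G (w, u) + ∂_w G (v, u) - ∂_u G (v, w))` at the point `y`
(the Christoffel symbols of the first kind). -/
def christoffelFirst (G : E → E →L[ℝ] E →L[ℝ] ℝ) (y : E) : E →L[ℝ] E →L[ℝ] E →L[ℝ] ℝ :=
  let D : E →L[ℝ] E →L[ℝ] E →L[ℝ] ℝ := fderiv ℝ G y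
  let T : (E →L[ℝ] E →L[ℝ] ℝ) →L[ℝ] E →L[ℝ] E →L[ℝ] ℝ :=
    (ContinuousLinearMap.flipₗᵢ ℝ E E ℝ).toContinuousLinearEquiv.toContinuousLinearMap
  (1 / 2 : ℝ) • (D + D.flip - T.comp D.flip)

theorem christoffelFirst_apply (G : E → E →L[ℝ] E →L[ℝ] ℝ) (y v w u : E) :
    christoffelFirst G y v w u =
      1 / 2 * (fderiv ℝ G y v w u + fderiv ℝ G y w v u - fderiv ℝ G y u v w) := by
  simp [christoffelFirst]

/-- The Christoffel symbols (of the second kind): `christoffel G y v w` is the vector `z` with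
`G y z u = christoffelFirst G y v w u` for all `u`, that is, the Levi-Civita covariant derivative
at `y` of the constant vector field `w` in the direction `v`, for the metric `G`. -/
def christoffel (G : E → E →L[ℝ] E →L[ℝ] ℝ) (y : E) : E →L[ℝ] E →L[ℝ] E :=
  (ContinuousLinearMap.compL ℝ E (E →L[ℝ] ℝ) E (G y).inverse).comp (christoffelFirst G y)

theorem christoffel_apply (G : E → E →L[ℝ] E →L[ℝ] ℝ) (y v w : E) :
    christoffel G y v w = (G y).inverse (christoffelFirst G y v w) := rfl

/-- The endomorphism `u ↦ R(u, v) w` of `E`, where `R` is the Riemann curvature tensor of the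
metric `G` at `y`, with the convention `R(X, Y) Z = ∇_X ∇_Y Z - ∇_Y ∇_X Z - ∇_[X, Y] Z`. -/
def curvatureEnd (G : E → E →L[ℝ] E →L[ℝ] ℝ) (y v w : E) : E →L[ℝ] E :=
  ((fderiv ℝ (christoffel G) y).flip v).flip w - (fderiv ℝ (christoffel G) y v).flip w
    + (christoffel G y).flip (christoffel G y v w)
    - (christoffel G y v).comp ((christoffel G y).flip w)

theorem curvatureEnd_apply (G : E → E →L[ℝ] E →L[ℝ] ℝ) (y v w u : E) :
    curvatureEnd G y v w u =
      fderiv ℝ (christoffel G) y u v w - fderiv ℝ (christoffel G) y v u w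
        + christoffel G y u (christoffel G y v w) - christoffel G y v (christoffel G y u w) := by
  simp [curvatureEnd]

/-- The Ricci curvature of the metric `G` on (an open subset of) the vector space `E`:
the trace of `u ↦ R(u, v) w`. -/
def localRicci (G : E → E →L[ℝ] E →L[ℝ] ℝ) (y v w : E) : ℝ :=
  LinearMap.trace ℝ E (curvatureEnd G y v w : E →ₗ[ℝ] E)

/-- The Hessian `(∇ dh)(v, w)` of the function `h` for the metric `G` on (an open subset of) the
vector space `E`. -/
def localHessian (G : E → E →L[ℝ] E →L[ℝ] ℝ) (h : E → ℝ) (y v w : E) : ℝ :=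
  fderiv ℝ (fderiv ℝ h) y v w - fderiv ℝ h y (christoffel G y v w)

end Local

/-- The pull-back `(v, w) ↦ b (A v, A w)` of a bilinear form `b` under a linear map `A`. -/
def pullForm {V W : Type*} [AddCommGroup V] [Module ℝ V] [TopologicalSpace V]
    [AddCommGroup W] [Module ℝ W] [TopologicalSpace W]
    (b : V →L[ℝ] V →L[ℝ] ℝ) (A : W →L[ℝ] V) : W →L[ℝ] W →L[ℝ] ℝ :=
  (ContinuousLinearMap.precomp ℝ A).comp (b.comp A)

theorem pullForm_apply {V W : Type*} [AddCommGroup V] [Module ℝ V] [TopologicalSpace V]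
    [AddCommGroup W] [Module ℝ W] [TopologicalSpace W]
    (b : V →L[ℝ] V →L[ℝ] ℝ) (A : W →L[ℝ] V) (v w : W) : pullForm b A v w = b (A v) (A w) := rfl

section Manifold

variable {E : Type*} [NormedAddCommGroup E] [NormedSpace ℝ E]
  {H : Type*} [TopologicalSpace H] (I : ModelWithCorners ℝ E H)
  {M : Type*} [TopologicalSpace M] [ChartedSpace H M]

variable (M) in
/-- Fields of bilinear forms on the tangent spaces of `M`, i.e. (0,2)-tensor fields. -/
abbrev BilinField : Type _ :=
  ∀ x : M, TangentSpace I x →L[ℝ] TangentSpace I x →L[ℝ] ℝ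

/-- The coordinate expression of the tensor field `g` in the preferred chart around `p`, i.e. its
pull-back under the inverse of the chart. (All manifolds here are without boundary.) -/
def inChart (g : BilinField I M) (p : M) (y : E) : E →L[ℝ] E →L[ℝ] ℝ :=
  pullForm (g ((extChartAt I p).symm y)) (mfderiv 𝓘(ℝ, E) I (extChartAt I p).symm y)

theorem inChart_apply (g : BilinField I M) (p : M) (y v w : E) :
    inChart I g p y v w = g ((extChartAt I p).symm y)
      (mfderiv 𝓘(ℝ, E) I (extChartAt I p).symm y v)
      (mfderiv 𝓘(ℝ, E) I (extChartAt I p).symm y w) := rfl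

/-- The Ricci tensor of the metric `g` at the point `p`, computed in the chart around `p`. -/
def ricciTensor (g : BilinField I M) (p : M) (v w : TangentSpace I p) : ℝ :=
  localRicci (inChart I g p) (extChartAt I p p)
    (mfderiv I 𝓘(ℝ, E) (extChartAt I p) p v) (mfderiv I 𝓘(ℝ, E) (extChartAt I p) p w)

/-- The Hessian of the function `h` for the metric `g` at `p`, computed in the chart around `p`. -/
def hessianTensor (g : BilinField I M) (h : M → ℝ) (p : M) (v w : TangentSpace I p) : ℝ :=
  localHessian (inChart I g p) (h ∘ (extChartAt I p).symm) (extChartAt I p p)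
    (mfderiv I 𝓘(ℝ, E) (extChartAt I p) p v) (mfderiv I 𝓘(ℝ, E) (extChartAt I p) p w)

/-- `g` is a semi-Riemannian metric on the open subset `U` of `M`: a symmetric, nondegenerate
(0,2)-tensor field of constant index (there are orthonormal bases at all points of `U` with the
same signs) whose components in charts are smooth. -/
structure IsSemiRiemannianOn (g : BilinField I M) (U : Set M) : Prop where
  symm : ∀ p ∈ U, ∀ v w, g p v w = g p w v
  nondegenerate : ∀ p ∈ U, ∀ v, (∀ w, g p v w = 0) → v = 0
  constant_index : ∃ η : Fin (finrank ℝ E) → ℝ, (∀ i, η i = 1 ∨ η i = -1) ∧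
    ∀ p ∈ U, ∃ b : Basis (Fin (finrank ℝ E)) ℝ (TangentSpace I p),
      ∀ i j, g p (b i) (b j) = if i = j then η i else 0
  smooth : ∀ p : M, ContDiffOn ℝ ∞ (inChart I g p)
    ((extChartAt I p).target ∩ (extChartAt I p).symm ⁻¹' U)

/-- The open subset `U` of `M` with the metric `g` and the function `h` is a quasi-Einstein
semi-Riemannian manifold: `Ric_g - (r / h) Hess_g h = ρ g` on `U`, where `h` is a smooth
nowhere vanishing function on `U`. -/
structure IsQuasiEinsteinOn (g : BilinField I M) (h : M → ℝ) (r ρ : ℝ) (U : Set M) : Prop where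
  isOpen : IsOpen U
  metric : IsSemiRiemannianOn I g U
  smooth : ContMDiffOn I 𝓘(ℝ) ∞ h U
  ne_zero : ∀ p ∈ U, h p ≠ 0
  eqn : ∀ p ∈ U, ∀ v w : TangentSpace I p,
    ricciTensor I g p v w - r / h p * hessianTensor I g h p v w = ρ * g p v w

end Manifold

section Warped

variable {E : Type*} [NormedAddCommGroup E] [NormedSpace ℝ E]
  {H : Type*} [TopologicalSpace H] (I : ModelWithCorners ℝ E H)
  {B : Type*} [TopologicalSpace B] [ChartedSpace H B]
  {E' : Type*} [NormedAddCommGroup E'] [NormedSpace ℝ E']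
  {H' : Type*} [TopologicalSpace H'] (I' : ModelWithCorners ℝ E' H')
  {F : Type*} [TopologicalSpace F] [ChartedSpace H' F]

/-- The warped product metric `g_B ⊕ f² g_F` on `B × F`, i.e. `π_B^* g_B + (f ∘ π_B)² π_F^* g_F`. -/
def warpedMetric (gB : BilinField I B) (f : B → ℝ) (gF : BilinField I' F) :
    BilinField (I.prod I') (B × F) := fun p =>
  pullForm (gB p.1) (mfderiv (I.prod I') I Prod.fst p)
    + (f p.1) ^ 2 • pullForm (gF p.2) (mfderiv (I.prod I') I' Prod.snd p)

theorem warpedMetric_apply (gB : BilinField I B) (f : B → ℝ) (gF : BilinField I' F) (p : B × F)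
    (v w : TangentSpace (I.prod I') p) :
    warpedMetric I I' gB f gF p v w =
      gB p.1 (mfderiv (I.prod I') I Prod.fst p v) (mfderiv (I.prod I') I Prod.fst p w)
        + f p.1 ^ 2 * gF p.2 (mfderiv (I.prod I') I' Prod.snd p v)
            (mfderiv (I.prod I') I' Prod.snd p w) := rfl

end Warped

section PseudoEuclidean

variable {n : ℕ}

/-- The pseudo-Euclidean scalar product `∑ ε_i v_i w_i` on `ℝ^n`. -/
def pseudoEuclideanForm (ε : Fin n → ℝ) :
    EuclideanSpace ℝ (Fin n) →L[ℝ] EuclideanSpace ℝ (Fin n) →L[ℝ] ℝ :=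
  ∑ i, ε i • (EuclideanSpace.proj i : EuclideanSpace ℝ (Fin n) →L[ℝ] ℝ).smulRight
    (EuclideanSpace.proj i : EuclideanSpace ℝ (Fin n) →L[ℝ] ℝ)

theorem pseudoEuclideanForm_apply (ε : Fin n → ℝ) (v w : EuclideanSpace ℝ (Fin n)) :
    pseudoEuclideanForm ε v w = ∑ i, ε i * (v i * w i) := by
  simp [pseudoEuclideanForm]

/-- The metric `φ⁻² ∑ ε_i dx_i²` on `ℝ^n`. -/
def conformalMetric (ε : Fin n → ℝ) (φ : EuclideanSpace ℝ (Fin n) → ℝ) :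
    BilinField (𝓡 n) (EuclideanSpace ℝ (Fin n)) := fun x =>
  (1 / φ x ^ 2) • pseudoEuclideanForm ε

/-- The basic invariant `ξ = ∑ α_i x_i` of the translation group orthogonal to it. -/
def basicInvariant (α : Fin n → ℝ) (x : EuclideanSpace ℝ (Fin n)) : ℝ := ∑ i, α i * x i

/-- The metric `φ(ξ)⁻² ∑ ε_i dx_i² + f(ξ)² g_F` on `ℝ^n × F`. -/
def invariantWarpedMetric {m : ℕ} {F : Type*} [TopologicalSpace F]
    [ChartedSpace (EuclideanSpace ℝ (Fin m)) F] (ε α : Fin n → ℝ) (f φ : ℝ → ℝ)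
    (gF : BilinField (𝓡 m) F) :
    BilinField ((𝓡 n).prod (𝓡 m)) (EuclideanSpace ℝ (Fin n) × F) :=
  warpedMetric (𝓡 n) (𝓡 m) (conformalMetric ε fun x => φ (basicInvariant α x))
    (fun x => f (basicInvariant α x)) gF

end PseudoEuclidean

end

/-! Because `α` is null for `∑ ε_i dx_i²`, the vector `a` dual to `l = dξ` satisfies `l a = 0`. A
warped product with a conformally flat base usually has curvature terms proportional to `|∇ξ|²`;
here all of them vanish. What remains is a multiple of `l ⊗ l`, besides the Ricci tensor of the
fibre, which is zero: Ric = Ric_F + [(n-2) φ''/φ - m (f''/f + 2 φ'f'/(φf))] l ⊗ l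
(`IsNullWarping.localRicci_eq`), Hess h = (h'' + 2 φ'h'/φ) l ⊗ l (`IsNullWarping.localHessian_eq`).
Hence the whole tensor equation with `ρ = 0` is one scalar equation, and multiplying it by `f φ h`
gives the linear ODE. Both formulas follow from explicit Christoffel symbols
(`christoffel_warpedForm`) and a block computation of the trace (`trace_warpedCurvature`). They
transfer to the manifold because the base chart is the identity, so the metric in a product chart is
again of the form `warpedForm` (`inChart_invariantWarpedMetric`). For the infinite family, `f = 1`
and exponential `φ`, `h` turn the ODE into a quadratic equation for the ratio of the exponents. -/

/-! ### Levi-Civita calculus of a metric on a vector space. -/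

section LeviCivita

variable {E : Type*} [NormedAddCommGroup E] [NormedSpace ℝ E]

theorem isInvertible_of_nondegenerate [FiniteDimensional ℝ E] {b : E →L[ℝ] E →L[ℝ] ℝ}
    (hb : ∀ v, (∀ w, b v w = 0) → v = 0) : b.IsInvertible := by
  have hinj : Function.Injective b :=
    (injective_iff_map_eq_zero b).2 fun v hv => hb v fun w => by simp [hv]
  have hdim : finrank ℝ E = finrank ℝ (E →L[ℝ] ℝ) := by
    rw [← (LinearMap.toContinuousLinearMap : (E →ₗ[ℝ] ℝ) ≃ₗ[ℝ] (E →L[ℝ] ℝ)).finrank_eq]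
    exact (Subspace.dual_finrank_eq (K := ℝ) (V := E)).symm
  refine ⟨(LinearEquiv.ofInjectiveOfFinrankEq (b : E →ₗ[ℝ] E →L[ℝ] ℝ) hinj
    hdim).toContinuousLinearEquiv, ?_⟩
  ext v w
  rfl

/-- Nondegeneracy makes `G y` invertible, so `inverse` is a genuine inverse rather than its default
value 0. Christoffel symbols can then be found by guessing and testing against all `u`. -/
theorem christoffel_eq_of_forall [FiniteDimensional ℝ E] {G : E → E →L[ℝ] E →L[ℝ] ℝ} {y v w z : E}
    (hG : ∀ v, (∀ w, G y v w = 0) → v = 0) (h : ∀ u, G y z u = christoffelFirst G y v w u) :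
    christoffel G y v w = z := by
  rw [christoffel_apply, (isInvertible_of_nondegenerate hG).inverse_apply_eq]
  ext u
  exact (h u).symm

theorem apply_christoffel [FiniteDimensional ℝ E] {G : E → E →L[ℝ] E →L[ℝ] ℝ} {y : E}
    (hG : ∀ v, (∀ w, G y v w = 0) → v = 0) (v w u : E) :
    G y (christoffel G y v w) u = christoffelFirst G y v w u := by
  rw [christoffel_apply, (isInvertible_of_nondegenerate hG).self_apply_inverse]

theorem fderiv_apply_apply {E' : Type*} [NormedAddCommGroup E'] [NormedSpace ℝ E']
    {T : E → E →L[ℝ] E →L[ℝ] E'} {y : E}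
    (hT : DifferentiableAt ℝ T y) (v w u : E) :
    fderiv ℝ T y u v w = fderiv ℝ (fun z => T z v w) y u := by
  have h := (hT.hasFDerivAt.clm_apply (hasFDerivAt_const v y)).clm_apply (hasFDerivAt_const w y)
  rw [h.fderiv]
  simp

theorem christoffelFirst_comm {G : E → E →L[ℝ] E →L[ℝ] ℝ} {y : E} (hd : DifferentiableAt ℝ G y)
    (hs : ∀ᶠ z in nhds y, ∀ v w, G z v w = G z w v) (v w u : E) :
    christoffelFirst G y v w u = christoffelFirst G y w v u := by
  have h : fderiv ℝ G y u v w = fderiv ℝ G y u w v := by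
    rw [fderiv_apply_apply hd, fderiv_apply_apply hd]
    have : (fun z => G z v w) =ᶠ[nhds y] fun z => G z w v := hs.mono fun z hz => hz v w
    rw [this.fderiv_eq]
  rw [christoffelFirst_apply, christoffelFirst_apply, h]
  ring

theorem christoffel_comm {G : E → E →L[ℝ] E →L[ℝ] ℝ} {y : E} (hd : DifferentiableAt ℝ G y)
    (hs : ∀ᶠ z in nhds y, ∀ v w, G z v w = G z w v) (v w : E) :
    christoffel G y v w = christoffel G y w v := by
  rw [christoffel_apply, christoffel_apply]
  congr 1
  ext u
  exact christoffelFirst_comm hd hs v w u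

theorem differentiableAt_christoffel [FiniteDimensional ℝ E] {G : E → E →L[ℝ] E →L[ℝ] ℝ} {y : E}
    (hd : ContDiffAt ℝ 2 G y) (hG : ∀ v, (∀ w, G y v w = 0) → v = 0) :
    DifferentiableAt ℝ (christoffel G) y := by
  have : CompleteSpace E := FiniteDimensional.complete ℝ E
  have h1 : DifferentiableAt ℝ (fun z => (G z).inverse) y :=
    (((isInvertible_of_nondegenerate hG).contDiffAt_map_inverse (n := 1)).comp y
      (hd.of_le (by norm_num))).differentiableAt (by norm_num)
  have h2 : DifferentiableAt ℝ (fderiv ℝ G) y :=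
    (hd.fderiv_right (m := 1) (by norm_num)).differentiableAt (by norm_num)
  have h3 : DifferentiableAt ℝ (christoffelFirst G) y := by
    have h4 : DifferentiableAt ℝ (fun z => (fderiv ℝ G z).flip) y :=
      (ContinuousLinearMap.flipₗᵢ ℝ E E
        (E →L[ℝ] ℝ)).toContinuousLinearEquiv.differentiableAt.comp y h2
    exact ((h2.add h4).sub ((differentiableAt_const _).clm_comp h4)).const_smul (1 / 2 : ℝ)
  exact ((ContinuousLinearMap.compL ℝ E (E →L[ℝ] ℝ) E).differentiableAt.comp y h1).clm_comp h3

theorem christoffel_congr {G G' : E → E →L[ℝ] E →L[ℝ] ℝ} {y : E} (h : G =ᶠ[nhds y] G') :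
    christoffel G y = christoffel G' y := by
  simp only [christoffel, christoffelFirst, h.fderiv_eq, h.eq_of_nhds]

/-- Ricci curvature depends only on the germ of the metric. This matters because the chart
expression agrees with the model form only over the chart target. -/
theorem localRicci_congr {G G' : E → E →L[ℝ] E →L[ℝ] ℝ} {y : E} (h : G =ᶠ[nhds y] G') :
    localRicci G y = localRicci G' y := by
  have h' : christoffel G =ᶠ[nhds y] christoffel G' :=
    h.eventuallyEq_nhds.mono fun z hz => christoffel_congr hz
  funext v w
  simp only [localRicci, curvatureEnd, h'.fderiv_eq, h'.eq_of_nhds]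

theorem localHessian_congr {G G' : E → E →L[ℝ] E →L[ℝ] ℝ} {k k' : E → ℝ} {y : E}
    (h : G =ᶠ[nhds y] G') (hk : k =ᶠ[nhds y] k') :
    localHessian G k y = localHessian G' k' y := by
  funext v w
  simp only [localHessian, christoffel_congr h, hk.fderiv_eq, hk.fderiv.fderiv_eq]

end LeviCivita

/-- The identity of `V × W` is `inl ∘ fst + inr ∘ snd`; compose with `T` and use cyclicity of the
trace. -/
theorem trace_prod_eq {V W : Type*} [AddCommGroup V] [Module ℝ V] [FiniteDimensional ℝ V]
    [AddCommGroup W] [Module ℝ W] [FiniteDimensional ℝ W] (T : V × W →ₗ[ℝ] V × W) :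
    LinearMap.trace ℝ (V × W) T =
      LinearMap.trace ℝ V (LinearMap.fst ℝ V W ∘ₗ T ∘ₗ LinearMap.inl ℝ V W)
        + LinearMap.trace ℝ W (LinearMap.snd ℝ V W ∘ₗ T ∘ₗ LinearMap.inr ℝ V W) := by
  rw [LinearMap.trace_comp_comm' (T ∘ₗ LinearMap.inl ℝ V W),
    LinearMap.trace_comp_comm' (T ∘ₗ LinearMap.inr ℝ V W), ← map_add,
    LinearMap.comp_assoc, LinearMap.comp_assoc, ← LinearMap.comp_add]
  congr 1
  ext <;> simp

/-! ### Christoffel symbols of a warped product with conformally flat base. -/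

section WarpedProduct

variable {V W : Type*} [NormedAddCommGroup V] [NormedSpace ℝ V]
  [NormedAddCommGroup W] [NormedSpace ℝ W]

/-- The field of bilinear forms `φ(l x)⁻² η + f(l x)² GF(y)` on `V × W`. -/
noncomputable def warpedForm (η : V →L[ℝ] V →L[ℝ] ℝ) (l : V →L[ℝ] ℝ) (f φ : ℝ → ℝ)
    (GF : W → W →L[ℝ] W →L[ℝ] ℝ) (z : V × W) : V × W →L[ℝ] V × W →L[ℝ] ℝ :=
  (1 / φ (l z.1) ^ 2) • pullForm η (ContinuousLinearMap.fst ℝ V W)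
    + f (l z.1) ^ 2 • pullForm (GF z.2) (ContinuousLinearMap.snd ℝ V W)

theorem warpedForm_apply (η : V →L[ℝ] V →L[ℝ] ℝ) (l : V →L[ℝ] ℝ) (f φ : ℝ → ℝ)
    (GF : W → W →L[ℝ] W →L[ℝ] ℝ) (z v w : V × W) :
    warpedForm η l f φ GF z v w =
      1 / φ (l z.1) ^ 2 * η v.1 w.1 + f (l z.1) ^ 2 * GF z.2 v.2 w.2 := rfl

theorem warpedForm_comm {η : V →L[ℝ] V →L[ℝ] ℝ} (hη : ∀ v w, η v w = η w v)
    (l : V →L[ℝ] ℝ) (f φ : ℝ → ℝ) {GF : W → W →L[ℝ] W →L[ℝ] ℝ} {z : V × W}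
    (hGF : ∀ v w, GF z.2 v w = GF z.2 w v) (v w : V × W) :
    warpedForm η l f φ GF z v w = warpedForm η l f φ GF z w v := by
  rw [warpedForm_apply, warpedForm_apply, hη, hGF]

theorem warpedForm_nondegenerate {η : V →L[ℝ] V →L[ℝ] ℝ}
    (hη : ∀ v, (∀ w, η v w = 0) → v = 0) {l : V →L[ℝ] ℝ} {f φ : ℝ → ℝ}
    {GF : W → W →L[ℝ] W →L[ℝ] ℝ} {z : V × W} (hf : f (l z.1) ≠ 0) (hφ : φ (l z.1) ≠ 0)
    (hGF : ∀ v, (∀ w, GF z.2 v w = 0) → v = 0) (v : V × W)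
    (h : ∀ w, warpedForm η l f φ GF z v w = 0) : v = 0 := by
  ext1
  · refine hη _ fun w => ?_
    simpa [warpedForm_apply, hφ] using h (w, 0)
  · refine hGF _ fun w => ?_
    simpa [warpedForm_apply, hf] using h (0, w)

theorem contDiffOn_warpedForm (η : V →L[ℝ] V →L[ℝ] ℝ) (l : V →L[ℝ] ℝ) {f φ : ℝ → ℝ}
    {GF : W → W →L[ℝ] W →L[ℝ] ℝ} {J : Set ℝ} {T : Set W} (hf : ContDiffOn ℝ ∞ f J)
    (hφ : ContDiffOn ℝ ∞ φ J) (hφ0 : ∀ t ∈ J, φ t ≠ 0) (hGF : ContDiffOn ℝ ∞ GF T) :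
    ContDiffOn ℝ ∞ (warpedForm η l f φ GF) {z | l z.1 ∈ J ∧ z.2 ∈ T} := by
  have hl : ContDiffOn ℝ ∞ (fun z : V × W => l z.1) {z | l z.1 ∈ J ∧ z.2 ∈ T} :=
    (l.contDiff.comp contDiff_fst).contDiffOn
  have hf' := hf.comp hl fun z hz => hz.1
  have hφ' := hφ.comp hl fun z hz => hz.1
  have hG' := hGF.comp (contDiff_snd (𝕜 := ℝ) (E := V)).contDiffOn
    (s := {z : V × W | l z.1 ∈ J ∧ z.2 ∈ T}) fun z hz => hz.2
  refine ContDiffOn.add (ContDiffOn.fun_smul ?_ contDiffOn_const) (ContDiffOn.fun_smul (hf'.pow 2) ?_)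
  · exact contDiffOn_const.div (hφ'.pow 2) fun z hz => pow_ne_zero 2 (hφ0 _ hz.1)
  · exact contDiffOn_const.clm_comp (hG'.clm_comp contDiffOn_const)

theorem hasFDerivAt_comp_fst {l : V →L[ℝ] ℝ} {c : ℝ → ℝ} {c' : ℝ} {z : V × W}
    (hc : HasDerivAt c c' (l z.1)) :
    HasFDerivAt (fun z : V × W => c (l z.1)) (c' • l ∘L ContinuousLinearMap.fst ℝ V W) z :=
  hc.comp_hasFDerivAt z (l.comp (ContinuousLinearMap.fst ℝ V W)).hasFDerivAt

theorem hasFDerivAt_comp_snd {E' : Type*} [NormedAddCommGroup E'] [NormedSpace ℝ E']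
    {T : W → W →L[ℝ] W →L[ℝ] E'} {z : V × W} (hT : DifferentiableAt ℝ T z.2) (v w : W) :
    HasFDerivAt (fun z : V × W => T z.2 v w)
      (fderiv ℝ (fun y => T y v w) z.2 ∘L ContinuousLinearMap.snd ℝ V W) z :=
  HasFDerivAt.comp z (g := fun y => T y v w) (f := Prod.snd)
    ((hT.clm_apply (differentiableAt_const v)).clm_apply
      (differentiableAt_const w)).hasFDerivAt hasFDerivAt_snd

theorem fderiv_warpedForm {η : V →L[ℝ] V →L[ℝ] ℝ} {l : V →L[ℝ] ℝ} {f φ : ℝ → ℝ}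
    {GF : W → W →L[ℝ] W →L[ℝ] ℝ} {z : V × W} {f' φ' : ℝ}
    (hd : DifferentiableAt ℝ (warpedForm η l f φ GF) z)
    (hf : HasDerivAt f f' (l z.1)) (hφ : HasDerivAt φ φ' (l z.1)) (hφ0 : φ (l z.1) ≠ 0)
    (hG : DifferentiableAt ℝ GF z.2) (u v w : V × W) :
    fderiv ℝ (warpedForm η l f φ GF) z u v w =
      -(2 * φ' / φ (l z.1) ^ 3) * l u.1 * η v.1 w.1
        + 2 * f (l z.1) * f' * l u.1 * GF z.2 v.2 w.2
        + f (l z.1) ^ 2 * fderiv ℝ GF z.2 u.2 v.2 w.2 := by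
  rw [fderiv_apply_apply hd, fderiv_apply_apply hG]
  have h1 : HasDerivAt (fun t => 1 / φ t ^ 2) (-(2 * φ' / φ (l z.1) ^ 3)) (l z.1) := by
    refine ((hasDerivAt_const _ (1 : ℝ)).div (hφ.pow 2) (pow_ne_zero 2 hφ0)).congr_deriv ?_
    simp only [Pi.pow_apply]
    field_simp
    ring
  have h2 : HasDerivAt (fun t => f t ^ 2) (2 * f (l z.1) * f') (l z.1) := by
    refine (hf.pow 2).congr_deriv ?_
    ring
  have h := ((hasFDerivAt_comp_fst (W := W) h1).mul_const (η v.1 w.1)).add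
    ((hasFDerivAt_comp_fst (W := W) h2).mul (hasFDerivAt_comp_snd hG v.2 w.2))
  have h' : HasFDerivAt (fun z => warpedForm η l f φ GF z v w) _ z := h
  rw [h'.fderiv]
  simp
  ring

/-- The Christoffel symbols of `warpedForm`, in terms of `p = -φ' / φ`, `q = f' / f` and
`s = -f f' φ²`. -/
noncomputable def warpedChristoffel (η : V →L[ℝ] V →L[ℝ] ℝ) (l : V →L[ℝ] ℝ) (a : V) (p q s : ℝ)
    (b : W →L[ℝ] W →L[ℝ] ℝ) (Γ : W →L[ℝ] W →L[ℝ] W) (v w : V × W) : V × W :=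
  (p • (l v.1 • w.1 + l w.1 • v.1 - η v.1 w.1 • a) + (s * b v.2 w.2) • a,
    Γ v.2 w.2 + q • (l v.1 • w.2 + l w.1 • v.2))

/-- Since `η` is constant, only `φ⁻²`, `f²` and `GF` are differentiated in the Koszul formula. The
terms containing `l u` become components along `a` through `η a u = l u`. -/
theorem christoffel_warpedForm [FiniteDimensional ℝ V] [FiniteDimensional ℝ W]
    {η : V →L[ℝ] V →L[ℝ] ℝ} (hη : ∀ v w, η v w = η w v) (hη0 : ∀ v, (∀ w, η v w = 0) → v = 0)
    {l : V →L[ℝ] ℝ} {a : V} (ha : ∀ v, η a v = l v) {f φ : ℝ → ℝ}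
    {GF : W → W →L[ℝ] W →L[ℝ] ℝ} {z : V × W} {f' φ' : ℝ}
    (hd : DifferentiableAt ℝ (warpedForm η l f φ GF) z)
    (hf : HasDerivAt f f' (l z.1)) (hφ : HasDerivAt φ φ' (l z.1))
    (hf0 : f (l z.1) ≠ 0) (hφ0 : φ (l z.1) ≠ 0)
    (hG : DifferentiableAt ℝ GF z.2)
    (hG0 : ∀ v, (∀ w, GF z.2 v w = 0) → v = 0) (v w : V × W) :
    christoffel (warpedForm η l f φ GF) z v w =
      warpedChristoffel η l a (-(φ' / φ (l z.1))) (f' / f (l z.1))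
        (-(f (l z.1) * f' * φ (l z.1) ^ 2)) (GF z.2) (christoffel GF z.2) v w := by
  refine christoffel_eq_of_forall (warpedForm_nondegenerate hη0 hf0 hφ0 hG0) fun u => ?_
  rw [christoffelFirst_apply, fderiv_warpedForm hd hf hφ hφ0 hG, fderiv_warpedForm hd hf hφ hφ0 hG,
    fderiv_warpedForm hd hf hφ hφ0 hG, warpedForm_apply]
  have hΓ := apply_christoffel hG0 v.2 w.2 u.2
  rw [christoffelFirst_apply] at hΓ
  simp only [warpedChristoffel, map_add, map_sub, map_smul, _root_.add_apply,
    _root_.sub_apply, _root_.smul_apply, smul_eq_mul, ha, hΓ]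
  rw [hη w.1 u.1, hη v.1 u.1, hη u.1 v.1, hη u.1 w.1]
  field_simp
  ring

end WarpedProduct

/-! ### Ricci tensor and Hessian when the gradient of the invariant is null. -/

section WarpedCurvature

variable {V W : Type*} [NormedAddCommGroup V] [NormedSpace ℝ V]
  [NormedAddCommGroup W] [NormedSpace ℝ W]

/-- The derivative in the direction `u` of `warpedChristoffel`. -/
noncomputable def warpedChristoffelDeriv (η : V →L[ℝ] V →L[ℝ] ℝ) (l : V →L[ℝ] ℝ) (a : V) (s p' q' s' : ℝ)
    (b : W →L[ℝ] W →L[ℝ] ℝ) (b' : W →L[ℝ] W →L[ℝ] W →L[ℝ] ℝ)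
    (Γ' : W →L[ℝ] W →L[ℝ] W →L[ℝ] W) (u v w : V × W) : V × W :=
  ((p' * l u.1) • (l v.1 • w.1 + l w.1 • v.1 - η v.1 w.1 • a)
      + (s' * l u.1 * b v.2 w.2 + s * b' u.2 v.2 w.2) • a,
    Γ' u.2 v.2 w.2 + (q' * l u.1) • (l v.1 • w.2 + l w.1 • v.2))

theorem fderiv_warpedChristoffel (η : V →L[ℝ] V →L[ℝ] ℝ) (l : V →L[ℝ] ℝ) (a : V)
    {p q s : ℝ → ℝ} {p' q' s' : ℝ} {GF : W → W →L[ℝ] W →L[ℝ] ℝ}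
    {ΓF : W → W →L[ℝ] W →L[ℝ] W} {z : V × W} (hp : HasDerivAt p p' (l z.1))
    (hq : HasDerivAt q q' (l z.1)) (hs : HasDerivAt s s' (l z.1))
    (hG : DifferentiableAt ℝ GF z.2) (hΓ : DifferentiableAt ℝ ΓF z.2) (u v w : V × W) :
    fderiv ℝ (fun z : V × W => warpedChristoffel η l a (p (l z.1)) (q (l z.1)) (s (l z.1))
        (GF z.2) (ΓF z.2) v w) z u =
      warpedChristoffelDeriv η l a (s (l z.1)) p' q' s' (GF z.2) (fderiv ℝ GF z.2)
        (fderiv ℝ ΓF z.2) u v w := by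
  have h1 := ((hasFDerivAt_comp_fst (W := W) hp).smul_const
    (l v.1 • w.1 + l w.1 • v.1 - η v.1 w.1 • a)).add
      (((hasFDerivAt_comp_fst (W := W) hs).mul (hasFDerivAt_comp_snd hG v.2 w.2)).smul_const a)
  have h2 := (hasFDerivAt_comp_snd hΓ v.2 w.2).add
    ((hasFDerivAt_comp_fst (W := W) hq).smul_const (l v.1 • w.2 + l w.1 • v.2))
  have h : HasFDerivAt (fun z : V × W => warpedChristoffel η l a (p (l z.1)) (q (l z.1))
    (s (l z.1)) (GF z.2) (ΓF z.2) v w) _ z := h1.prodMk h2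
  rw [h.fderiv, warpedChristoffelDeriv, fderiv_apply_apply hG, fderiv_apply_apply hΓ]
  ext1
  · simp
    module
  · simp

/-- The `V` block is a sum of rank-one maps plus `(p² - p') l(v) l(w)` times the identity. The trace
of a rank-one map is its functional evaluated at its vector, so `l a = 0` removes every term
containing `s`; the surviving rank-one terms contribute `-2 (p² - p') l(v) l(w)`, whence the factor
`dim V - 2`. The `W` block is the fibre curvature plus a multiple of the identity. -/
theorem trace_warpedCurvature [FiniteDimensional ℝ V] [FiniteDimensional ℝ W]
    {η : V →L[ℝ] V →L[ℝ] ℝ} (hη : ∀ v w, η v w = η w v) {l : V →L[ℝ] ℝ} {a : V}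
    (ha : ∀ v, η a v = l v) (hla : l a = 0) {p q s p' q' s' : ℝ} {b : W →L[ℝ] W →L[ℝ] ℝ}
    {b' : W →L[ℝ] W →L[ℝ] W →L[ℝ] ℝ} {Γ : W →L[ℝ] W →L[ℝ] W} (hΓ : ∀ v w, Γ v w = Γ w v)
    {Γ' : W →L[ℝ] W →L[ℝ] W →L[ℝ] W} {v w : V × W} {R : V × W →L[ℝ] V × W} {RF : W →L[ℝ] W}
    (hRF : ∀ u, RF u = Γ' u v.2 w.2 - Γ' v.2 u w.2 + Γ u (Γ v.2 w.2) - Γ v.2 (Γ u w.2))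
    (hR : ∀ u, R u = warpedChristoffelDeriv η l a s p' q' s' b b' Γ' u v w
      - warpedChristoffelDeriv η l a s p' q' s' b b' Γ' v u w
      + warpedChristoffel η l a p q s b Γ u (warpedChristoffel η l a p q s b Γ v w)
      - warpedChristoffel η l a p q s b Γ v (warpedChristoffel η l a p q s b Γ u w)) :
    LinearMap.trace ℝ (V × W) (R : V × W →ₗ[ℝ] V × W) =
      LinearMap.trace ℝ W (RF : W →ₗ[ℝ] W)
        + ((finrank ℝ V - 2) * (p ^ 2 - p') + finrank ℝ W * (2 * p * q - q' - q ^ 2))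
          * l v.1 * l w.1 := by
  have hηa (v : V) : η v a = l v := by rw [hη, ha]
  have hV : LinearMap.fst ℝ V W ∘ₗ (R : V × W →ₗ[ℝ] V × W) ∘ₗ LinearMap.inl ℝ V W =
      (l : V →ₗ[ℝ] ℝ).smulRight (p' • (l w.1 • v.1 - η v.1 w.1 • a) + (s' * b v.2 w.2) • a
          + p • (warpedChristoffel η l a p q s b Γ v w).1 - (p ^ 2 * l v.1) • w.1
          - (2 * p ^ 2 * l w.1) • v.1 + (p ^ 2 * η v.1 w.1) • a - (s * q * b v.2 w.2) • a)
        + (η w.1 : V →ₗ[ℝ] ℝ).smulRight ((p' * l v.1) • a)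
        + (η (warpedChristoffel η l a p q s b Γ v w).1 : V →ₗ[ℝ] ℝ).smulRight (-p • a)
        + (η v.1 : V →ₗ[ℝ] ℝ).smulRight ((p ^ 2 * l w.1) • a)
        + ((p ^ 2 - p') * l v.1 * l w.1) • LinearMap.id := by
    ext u
    simp only [LinearMap.comp_apply, LinearMap.inl_apply, ContinuousLinearMap.coe_coe,
      LinearMap.fst_apply, hR, warpedChristoffel, warpedChristoffelDeriv, LinearMap.add_apply,
      LinearMap.smulRight_apply, LinearMap.smul_apply, LinearMap.id_apply, map_add, map_sub, map_smul, map_zero, _root_.add_apply, _root_.sub_apply,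
      _root_.smul_apply, _root_.zero_apply, smul_eq_mul, hla, ha, hηa, hη u]
    module
  have hW : LinearMap.snd ℝ V W ∘ₗ (R : V × W →ₗ[ℝ] V × W) ∘ₗ LinearMap.inr ℝ V W =
      (RF : W →ₗ[ℝ] W) + ((2 * p * q - q' - q ^ 2) * l v.1 * l w.1) • LinearMap.id := by
    ext u
    simp only [LinearMap.comp_apply, LinearMap.inr_apply, ContinuousLinearMap.coe_coe,
      LinearMap.snd_apply, hR, hRF, warpedChristoffel, warpedChristoffelDeriv, LinearMap.add_apply,
      LinearMap.smul_apply, LinearMap.id_apply, map_add,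
      map_sub, map_smul, map_zero, _root_.zero_apply, smul_eq_mul, hla, hηa, hΓ u v.2]
    module
  rw [trace_prod_eq, hV, hW]
  simp only [map_add, map_smul, LinearMap.trace_smulRight, LinearMap.trace_id,
    ContinuousLinearMap.coe_coe, warpedChristoffel, map_sub, smul_eq_mul, hla, ha, hηa,
    _root_.add_apply, _root_.sub_apply, _root_.smul_apply]
  ring

theorem apply_warpedChristoffel_fst {η : V →L[ℝ] V →L[ℝ] ℝ} {l : V →L[ℝ] ℝ} {a : V}
    (hla : l a = 0) (p q s : ℝ) (b : W →L[ℝ] W →L[ℝ] ℝ) (Γ : W →L[ℝ] W →L[ℝ] W) (v w : V × W) :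
    l (warpedChristoffel η l a p q s b Γ v w).1 = 2 * p * l v.1 * l w.1 := by
  simp [warpedChristoffel, hla]
  ring

/-- The data of a warped product metric `φ(l x)⁻² η + f(l x)² GF(y)`, with `l = η(a, ·)` for a null
vector `a`, on the open set of all `(x, y)` with `l x ∈ J` and `y ∈ T`. -/
structure IsNullWarping (η : V →L[ℝ] V →L[ℝ] ℝ) (l : V →L[ℝ] ℝ) (a : V) (J : Set ℝ)
    (f φ : ℝ → ℝ) (T : Set W) (GF : W → W →L[ℝ] W →L[ℝ] ℝ) : Prop where
  comm_base : ∀ v w, η v w = η w v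
  nondegenerate_base : ∀ v, (∀ w, η v w = 0) → v = 0
  apply_vector : ∀ v, η a v = l v
  null : l a = 0
  isOpen_interval : IsOpen J
  contDiffOn_warping : ContDiffOn ℝ ∞ f J
  warping_ne_zero : ∀ t ∈ J, f t ≠ 0
  contDiffOn_conformal : ContDiffOn ℝ ∞ φ J
  conformal_ne_zero : ∀ t ∈ J, φ t ≠ 0
  isOpen_fiber : IsOpen T
  contDiffOn_fiber : ContDiffOn ℝ ∞ GF T
  comm_fiber : ∀ y ∈ T, ∀ v w, GF y v w = GF y w v
  nondegenerate_fiber : ∀ y ∈ T, ∀ v, (∀ w, GF y v w = 0) → v = 0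

theorem hasDerivAt_of_contDiffOn {c : ℝ → ℝ} {J : Set ℝ} (hc : ContDiffOn ℝ ∞ c J)
    (hJ : IsOpen J) {t : ℝ} (ht : t ∈ J) : HasDerivAt c (deriv c t) t :=
  ((hc.differentiableOn (by simp)).differentiableAt (hJ.mem_nhds ht)).hasDerivAt

namespace IsNullWarping

variable {η : V →L[ℝ] V →L[ℝ] ℝ} {l : V →L[ℝ] ℝ} {a : V} {J : Set ℝ} {f φ : ℝ → ℝ} {T : Set W}
  {GF : W → W →L[ℝ] W →L[ℝ] ℝ} {z : V × W}

theorem mem_nhds (hN : IsNullWarping η l a J f φ T GF) (hJ : l z.1 ∈ J) (hT : z.2 ∈ T) :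
    {z : V × W | l z.1 ∈ J ∧ z.2 ∈ T} ∈ nhds z :=
  ((hN.isOpen_interval.preimage (l.continuous.comp continuous_fst)).inter
    (hN.isOpen_fiber.preimage continuous_snd)).mem_nhds ⟨hJ, hT⟩

theorem contDiffAt (hN : IsNullWarping η l a J f φ T GF) (hJ : l z.1 ∈ J) (hT : z.2 ∈ T) :
    ContDiffAt ℝ ∞ (warpedForm η l f φ GF) z :=
  (contDiffOn_warpedForm η l hN.contDiffOn_warping hN.contDiffOn_conformal hN.conformal_ne_zero
    hN.contDiffOn_fiber).contDiffAt (hN.mem_nhds hJ hT)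

theorem contDiffAt_fiber (hN : IsNullWarping η l a J f φ T GF) {y : W} (hT : y ∈ T) :
    ContDiffAt ℝ ∞ GF y :=
  hN.contDiffOn_fiber.contDiffAt (hN.isOpen_fiber.mem_nhds hT)

variable [FiniteDimensional ℝ V] [FiniteDimensional ℝ W]

theorem christoffel_eq (hN : IsNullWarping η l a J f φ T GF) (hJ : l z.1 ∈ J) (hT : z.2 ∈ T)
    (v w : V × W) :
    christoffel (warpedForm η l f φ GF) z v w =
      warpedChristoffel η l a (-(deriv φ (l z.1) / φ (l z.1))) (deriv f (l z.1) / f (l z.1))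
        (-(f (l z.1) * deriv f (l z.1) * φ (l z.1) ^ 2)) (GF z.2) (christoffel GF z.2) v w :=
  christoffel_warpedForm hN.comm_base hN.nondegenerate_base hN.apply_vector
    ((hN.contDiffAt hJ hT).differentiableAt (by simp))
    (hasDerivAt_of_contDiffOn hN.contDiffOn_warping hN.isOpen_interval hJ)
    (hasDerivAt_of_contDiffOn hN.contDiffOn_conformal hN.isOpen_interval hJ)
    (hN.warping_ne_zero _ hJ) (hN.conformal_ne_zero _ hJ)
    ((hN.contDiffAt_fiber hT).differentiableAt (by simp)) (hN.nondegenerate_fiber _ hT) v w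

theorem localRicci_eq (hN : IsNullWarping η l a J f φ T GF) (hJ : l z.1 ∈ J) (hT : z.2 ∈ T)
    (v w : V × W) :
    localRicci (warpedForm η l f φ GF) z v w = localRicci GF z.2 v.2 w.2
      + ((finrank ℝ V - 2) * (deriv (deriv φ) (l z.1) / φ (l z.1))
        - finrank ℝ W * (deriv (deriv f) (l z.1) / f (l z.1)
          + 2 * (deriv φ (l z.1) / φ (l z.1)) * (deriv f (l z.1) / f (l z.1))))
        * l v.1 * l w.1 := by
  have hf := hasDerivAt_of_contDiffOn hN.contDiffOn_warping hN.isOpen_interval hJ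
  have hφ := hasDerivAt_of_contDiffOn hN.contDiffOn_conformal hN.isOpen_interval hJ
  have hf' := hasDerivAt_of_contDiffOn (((contDiffOn_infty_iff_deriv_of_isOpen
    hN.isOpen_interval).1 hN.contDiffOn_warping).2) hN.isOpen_interval hJ
  have hφ' := hasDerivAt_of_contDiffOn (((contDiffOn_infty_iff_deriv_of_isOpen
    hN.isOpen_interval).1 hN.contDiffOn_conformal).2) hN.isOpen_interval hJ
  have hf0 := hN.warping_ne_zero _ hJ
  have hφ0 := hN.conformal_ne_zero _ hJ
  have hGd := (hN.contDiffAt_fiber hT).differentiableAt (by simp)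
  have hΓd := differentiableAt_christoffel ((hN.contDiffAt_fiber hT).of_le (WithTop.coe_le_coe.2 (le_top : (2 : ℕ∞) ≤ ⊤)))
    (hN.nondegenerate_fiber _ hT)
  have hΓ : ∀ v w, christoffel GF z.2 v w = christoffel GF z.2 w v := christoffel_comm hGd
    (Filter.eventually_of_mem (hN.isOpen_fiber.mem_nhds hT) hN.comm_fiber)
  have hd := differentiableAt_christoffel ((hN.contDiffAt hJ hT).of_le (WithTop.coe_le_coe.2 (le_top : (2 : ℕ∞) ≤ ⊤)))
    (warpedForm_nondegenerate hN.nondegenerate_base hf0 hφ0 (hN.nondegenerate_fiber _ hT))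
  -- The explicit Christoffel symbols hold on a whole neighbourhood of `z`, so they may be
  -- differentiated there.
  have hD (u v w : V × W) := by
    have h := fderiv_warpedChristoffel η l a (p := fun t => -(deriv φ t / φ t))
      (q := fun t => deriv f t / f t) (s := fun t => -(f t * deriv f t * φ t ^ 2))
      (hφ'.div hφ hφ0).neg (hf'.div hf hf0) ((hf.mul hf').mul (hφ.pow 2)).neg hGd hΓd u v w
    have hev : (fun y => christoffel (warpedForm η l f φ GF) y v w) =ᶠ[nhds z] _ :=
      Filter.eventually_of_mem (hN.mem_nhds hJ hT) fun y hy => hN.christoffel_eq hy.1 hy.2 v w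
    exact (fderiv_apply_apply hd v w u).trans ((DFunLike.congr_fun hev.fderiv_eq u).trans h)
  have hR (u : V × W) := curvatureEnd_apply (warpedForm η l f φ GF) z v w u
  simp only [hD, hN.christoffel_eq hJ hT] at hR
  rw [localRicci, trace_warpedCurvature hN.comm_base hN.apply_vector hN.null hΓ
    (curvatureEnd_apply GF z.2 v.2 w.2) hR, localRicci]
  field_simp
  ring

/-- As `dh = h' l`, only `l` of the Christoffel symbols enters, and its components along `a` drop
out by nullity. -/
theorem localHessian_eq (hN : IsNullWarping η l a J f φ T GF) (hJ : l z.1 ∈ J) (hT : z.2 ∈ T)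
    {h : ℝ → ℝ} (hh : DifferentiableOn ℝ h J) (hh' : DifferentiableOn ℝ (deriv h) J)
    (v w : V × W) :
    localHessian (warpedForm η l f φ GF) (fun z => h (l z.1)) z v w =
      (deriv (deriv h) (l z.1) + 2 * (deriv φ (l z.1) / φ (l z.1)) * deriv h (l z.1))
        * l v.1 * l w.1 := by
  have h1 : ∀ y : V × W, l y.1 ∈ J → HasFDerivAt (fun z : V × W => h (l z.1)) _ y := fun y hy =>
    hasFDerivAt_comp_fst ((hh.differentiableAt (hN.isOpen_interval.mem_nhds hy)).hasDerivAt)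
  have h2 : fderiv ℝ (fun z : V × W => h (l z.1)) =ᶠ[nhds z]
      fun y => deriv h (l y.1) • l ∘L ContinuousLinearMap.fst ℝ V W :=
    Filter.eventually_of_mem (hN.mem_nhds hJ hT) fun y hy => (h1 y hy.1).fderiv
  have h3 := (hasFDerivAt_comp_fst (W := W) ((hh'.differentiableAt
    (hN.isOpen_interval.mem_nhds hJ)).hasDerivAt)).smul_const
      (l ∘L ContinuousLinearMap.fst ℝ V W)
  rw [localHessian, h2.fderiv_eq, h3.fderiv, (h1 z hJ).fderiv, hN.christoffel_eq hJ hT]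
  simp [apply_warpedChristoffel_fst hN.null]
  ring

end IsNullWarping

end WarpedCurvature

/-! ### Charts on the product of a vector space and a manifold. -/

section ProductCharts

variable {E : Type*} [NormedAddCommGroup E] [NormedSpace ℝ E]
  {H : Type*} [TopologicalSpace H] {I : ModelWithCorners ℝ E H}
  {M : Type*} [TopologicalSpace M] [ChartedSpace H M]

theorem extChartAt_prod_symm_apply {B : Type*} [NormedAddCommGroup B] [NormedSpace ℝ B]
    (p : B × M) (y : B × E) :
    (extChartAt (𝓘(ℝ, B).prod I) p).symm y = (y.1, (extChartAt I p.2).symm y.2) := by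
  rw [extChartAt_prod]
  rfl

theorem extChartAt_prod_apply_self {B : Type*} [NormedAddCommGroup B] [NormedSpace ℝ B]
    (p : B × M) : extChartAt (𝓘(ℝ, B).prod I) p p = (p.1, extChartAt I p.2 p.2) := by
  rw [extChartAt_prod]
  rfl

theorem mem_extChartAt_prod_target {B : Type*} [NormedAddCommGroup B] [NormedSpace ℝ B]
    {p : B × M} {y : B × E} :
    y ∈ (extChartAt (𝓘(ℝ, B).prod I) p).target ↔ y.2 ∈ (extChartAt I p.2).target := by
  rw [extChartAt_prod, PartialEquiv.prod_target, extChartAt_model_space_eq_id]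
  simp

variable [IsManifold I ∞ M]

/-- The derivative of the chart at its centre is onto, so the vanishing of the Ricci tensor covers
all coordinate vectors. -/
theorem localRicci_inChart_eq_zero {g : BilinField I M} {q : M}
    (h : ∀ v w : TangentSpace I q, ricciTensor I g q v w = 0) (v w : E) :
    localRicci (inChart I g q) (extChartAt I q q) v w = 0 := by
  have : IsManifold I 1 M := IsManifold.of_le (n := ∞) (by simp)
  have hi := isInvertible_mfderiv_extChartAt (I := I) (mem_extChartAt_source (I := I) q)
  obtain ⟨v', rfl⟩ := hi.surjective v
  obtain ⟨w', rfl⟩ := hi.surjective w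
  exact h v' w'

variable [I.Boundaryless]

theorem mdifferentiableAt_extChartAt_symm (q : M) {y : E} (hy : y ∈ (extChartAt I q).target) :
    MDifferentiableAt 𝓘(ℝ, E) I (extChartAt I q).symm y := by
  have : IsManifold I 1 M := IsManifold.of_le (n := ∞) (by simp)
  have h := mdifferentiableWithinAt_extChartAt_symm (I := I) hy
  rwa [I.range_eq_univ, mdifferentiableWithinAt_univ] at h

theorem isInvertible_mfderiv_extChartAt_symm (q : M) {y : E} (hy : y ∈ (extChartAt I q).target) :
    (mfderiv 𝓘(ℝ, E) I (extChartAt I q).symm y).IsInvertible := by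
  have : IsManifold I 1 M := IsManifold.of_le (n := ∞) (by simp)
  have h := isInvertible_mfderivWithin_extChartAt_symm (I := I) hy
  rwa [I.range_eq_univ, mfderivWithin_univ] at h

theorem inChart_nondegenerate {g : BilinField I M} {q : M} {y : E}
    (hy : y ∈ (extChartAt I q).target)
    (hg : ∀ v, (∀ w, g ((extChartAt I q).symm y) v w = 0) → v = 0) (v : E)
    (hv : ∀ w, inChart I g q y v w = 0) : v = 0 := by
  have hi := isInvertible_mfderiv_extChartAt_symm q hy
  refine hi.injective ((hg _ fun w => ?_).trans (map_zero _).symm)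
  obtain ⟨w', rfl⟩ := hi.surjective w
  exact hv w'

theorem mfderiv_extChartAt_prod_symm {B : Type*} [NormedAddCommGroup B] [NormedSpace ℝ B]
    (p : B × M) {y : B × E} (hy : y.2 ∈ (extChartAt I p.2).target) :
    mfderiv 𝓘(ℝ, B × E) (𝓘(ℝ, B).prod I) (extChartAt (𝓘(ℝ, B).prod I) p).symm y =
      (ContinuousLinearMap.fst ℝ B E).prod
        ((mfderiv 𝓘(ℝ, E) I (extChartAt I p.2).symm y.2 :
          E →L[ℝ] E) ∘L ContinuousLinearMap.snd ℝ B E) := by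
  have e : (extChartAt (𝓘(ℝ, B).prod I) p).symm =
      fun y : B × E => (y.1, (extChartAt I p.2).symm y.2) :=
    funext (extChartAt_prod_symm_apply p)
  rw [e]
  have h1 : HasMFDerivAt 𝓘(ℝ, B × E) 𝓘(ℝ, B) (Prod.fst : B × E → B) y
      (ContinuousLinearMap.fst ℝ B E) := hasFDerivAt_fst.hasMFDerivAt
  have h2 : HasMFDerivAt 𝓘(ℝ, B × E) 𝓘(ℝ, E) (Prod.snd : B × E → E) y
      (ContinuousLinearMap.snd ℝ B E) := hasFDerivAt_snd.hasMFDerivAt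
  exact (h1.prodMk ((mdifferentiableAt_extChartAt_symm p.2 hy).hasMFDerivAt.comp y h2)).mfderiv

end ProductCharts

/-! ### The invariant warped metric in charts. -/

section PseudoEuclideanWarped

variable {n m : ℕ} {F : Type*} [TopologicalSpace F] [ChartedSpace (EuclideanSpace ℝ (Fin m)) F]

theorem pseudoEuclideanForm_comm (ε : Fin n → ℝ) (v w : EuclideanSpace ℝ (Fin n)) :
    pseudoEuclideanForm ε v w = pseudoEuclideanForm ε w v := by
  simp only [pseudoEuclideanForm_apply, mul_comm (v _)]

theorem pseudoEuclideanForm_single_right (ε : Fin n → ℝ) (v : EuclideanSpace ℝ (Fin n))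
    (i : Fin n) : pseudoEuclideanForm ε v (EuclideanSpace.single i 1) = ε i * v i := by
  simp [pseudoEuclideanForm_apply]

theorem pseudoEuclideanForm_nondegenerate {ε : Fin n → ℝ} (hε : ∀ i, ε i ≠ 0)
    (v : EuclideanSpace ℝ (Fin n)) (h : ∀ w, pseudoEuclideanForm ε v w = 0) : v = 0 := by
  ext i
  simpa [pseudoEuclideanForm_single_right, hε i] using h (EuclideanSpace.single i 1)

/-- The vector dual to the functional `∑ α_i x_i` for the form `∑ ε_i dx_i²`, where `ε_i² = 1`. -/
noncomputable def dualVector (ε α : Fin n → ℝ) : EuclideanSpace ℝ (Fin n) := WithLp.toLp 2 fun i => ε i * α i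

theorem pseudoEuclideanForm_dualVector {ε : Fin n → ℝ} (hε : ∀ i, ε i * ε i = 1) (α : Fin n → ℝ)
    (x : EuclideanSpace ℝ (Fin n)) :
    pseudoEuclideanForm ε (dualVector ε α) x = basicInvariant α x := by
  rw [pseudoEuclideanForm_apply, basicInvariant]
  refine Finset.sum_congr rfl fun i _ => ?_
  simp only [dualVector]
  linear_combination (α i * x i) * hε i

theorem inChart_invariantWarpedMetric [IsManifold (𝓡 m) ∞ F] {ε : Fin n → ℝ}
    (hε : ∀ i, ε i * ε i = 1) (α : Fin n → ℝ) (f φ : ℝ → ℝ) (gF : BilinField (𝓡 m) F)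
    (p : EuclideanSpace ℝ (Fin n) × F) {y : EuclideanSpace ℝ (Fin n) × EuclideanSpace ℝ (Fin m)}
    (hy : y.2 ∈ (extChartAt (𝓡 m) p.2).target) :
    inChart ((𝓡 n).prod (𝓡 m)) (invariantWarpedMetric ε α f φ gF) p y =
      warpedForm (pseudoEuclideanForm ε) (pseudoEuclideanForm ε (dualVector ε α)) f φ
        (inChart (𝓡 m) gF p.2) y := by
  refine ContinuousLinearMap.ext fun v => ContinuousLinearMap.ext fun w => ?_
  rw [inChart_apply, mfderiv_extChartAt_prod_symm p hy, invariantWarpedMetric, warpedMetric_apply,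
    mfderiv_fst, mfderiv_snd, warpedForm_apply, pseudoEuclideanForm_dualVector hε]
  rfl

theorem isNullWarping_inChart [IsManifold (𝓡 m) ∞ F] {ε : Fin n → ℝ}
    (hε : ∀ i, ε i * ε i = 1) {α : Fin n → ℝ} (hα : ∑ i, ε i * α i ^ 2 = 0) {J : Set ℝ}
    (hJ : IsOpen J) {f φ : ℝ → ℝ} (hf : ContDiffOn ℝ ∞ f J) (hf0 : ∀ t ∈ J, 0 < f t)
    (hφ : ContDiffOn ℝ ∞ φ J) (hφ0 : ∀ t ∈ J, 0 < φ t) {gF : BilinField (𝓡 m) F}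
    (hgF : IsSemiRiemannianOn (𝓡 m) gF univ) (q : F) :
    IsNullWarping (pseudoEuclideanForm ε) (pseudoEuclideanForm ε (dualVector ε α))
      (dualVector ε α) J f φ (extChartAt (𝓡 m) q).target (inChart (𝓡 m) gF q) where
  comm_base := pseudoEuclideanForm_comm ε
  nondegenerate_base := pseudoEuclideanForm_nondegenerate fun i => left_ne_zero_of_mul_eq_one (hε i)
  apply_vector _ := rfl
  null := by
    rw [pseudoEuclideanForm_dualVector hε, basicInvariant, ← hα]
    refine Finset.sum_congr rfl fun i _ => ?_
    simp only [dualVector]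
    ring
  isOpen_interval := hJ
  contDiffOn_warping := hf
  warping_ne_zero t ht := (hf0 t ht).ne'
  contDiffOn_conformal := hφ
  conformal_ne_zero t ht := (hφ0 t ht).ne'
  isOpen_fiber := isOpen_extChartAt_target q
  contDiffOn_fiber := by simpa using hgF.smooth q
  comm_fiber _ _ v w := hgF.symm _ (mem_univ _) _ _
  nondegenerate_fiber _ hy := inChart_nondegenerate hy (hgF.nondegenerate _ (mem_univ _))

/-- Freezing the fibre metric at `p.2` as a constant field makes the pointwise algebra of
`warpedForm` available without charts; the second coordinate `0` is a dummy. -/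
theorem invariantWarpedMetric_eq_warpedForm {ε : Fin n → ℝ} (hε : ∀ i, ε i * ε i = 1)
    (α : Fin n → ℝ) (f φ : ℝ → ℝ) (gF : BilinField (𝓡 m) F) (p : EuclideanSpace ℝ (Fin n) × F)
    (v w : TangentSpace ((𝓡 n).prod (𝓡 m)) p) :
    invariantWarpedMetric ε α f φ gF p v w =
      warpedForm (pseudoEuclideanForm ε) (pseudoEuclideanForm ε (dualVector ε α)) f φ
        (fun _ : EuclideanSpace ℝ (Fin m) => gF p.2) (p.1, 0) v w := by
  refine Eq.trans ?_ (warpedForm_apply _ _ _ _ _ _ _ _).symm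
  rw [invariantWarpedMetric, warpedMetric_apply, mfderiv_fst, mfderiv_snd,
    pseudoEuclideanForm_dualVector hε]
  rfl

end PseudoEuclideanWarped

/-! ### The quasi-Einstein equation and the infinite family. -/

section QuasiEinstein

/-- Bootstrap: if `h` and `h'` are both `C^k`, the equation makes `h''` of class `C^k`, so both are
`C^(k+1)`. -/
theorem contDiffOn_of_linear_ode {J : Set ℝ} (hJ : IsOpen J) {a b h : ℝ → ℝ}
    (ha : ContDiffOn ℝ ∞ a J) (hb : ContDiffOn ℝ ∞ b J) (hh : DifferentiableOn ℝ h J)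
    (hh' : DifferentiableOn ℝ (deriv h) J)
    (hode : ∀ t ∈ J, deriv (deriv h) t = a t * deriv h t + b t * h t) : ContDiffOn ℝ ∞ h J := by
  have key (k : ℕ) : ContDiffOn ℝ k h J ∧ ContDiffOn ℝ k (deriv h) J := by
    induction k with
    | zero => exact ⟨contDiffOn_zero.2 hh.continuousOn, contDiffOn_zero.2 hh'.continuousOn⟩
    | succ k ih =>
      have hle : (k : WithTop ℕ∞) ≤ ∞ := mod_cast le_top
      push_cast
      refine ⟨(contDiffOn_succ_iff_deriv_of_isOpen hJ).2 ⟨hh, by simp, ih.2⟩,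
        (contDiffOn_succ_iff_deriv_of_isOpen hJ).2 ⟨hh', by simp, ?_⟩⟩
      exact (((ha.of_le hle).mul ih.2).add ((hb.of_le hle).mul ih.1)).congr hode
  exact contDiffOn_infty.2 fun k => (key k).1

variable {n m : ℕ} {F : Type*} [TopologicalSpace F] [ChartedSpace (EuclideanSpace ℝ (Fin m)) F]

theorem continuous_basicInvariant (α : Fin n → ℝ) : Continuous (basicInvariant α) := by
  unfold basicInvariant
  fun_prop

theorem contDiff_basicInvariant (α : Fin n → ℝ) : ContDiff ℝ ∞ (basicInvariant α) := by
  unfold basicInvariant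
  fun_prop

/-- Multiplying the base basis by `φ` and the fibre basis by `f⁻¹` cancels the conformal and warping
factors. The signs therefore do not depend on the point. -/
theorem exists_basis_warpedForm {V W : Type*} [NormedAddCommGroup V] [NormedSpace ℝ V]
    [NormedAddCommGroup W] [NormedSpace ℝ W] {ι κ μ : Type*} [DecidableEq ι] [DecidableEq κ]
    [DecidableEq μ] {η : V →L[ℝ] V →L[ℝ] ℝ} {l : V →L[ℝ] ℝ} {f φ : ℝ → ℝ}
    {GF : W → W →L[ℝ] W →L[ℝ] ℝ} {z : V × W} {ε : ι → ℝ} {δ : κ → ℝ} (b : Basis ι ℝ V)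
    (hb : ∀ i j, η (b i) (b j) = if i = j then ε i else 0) (c : Basis κ ℝ W)
    (hc : ∀ i j, GF z.2 (c i) (c j) = if i = j then δ i else 0)
    (hf : f (l z.1) ≠ 0) (hφ : φ (l z.1) ≠ 0) (e : μ ≃ ι ⊕ κ) :
    ∃ d : Basis μ ℝ (V × W), ∀ i j, warpedForm η l f φ GF z (d i) (d j) =
      if i = j then Sum.elim ε δ (e i) else 0 := by
  let d := ((b.isUnitSMul fun _ => hφ.isUnit).prod
    (c.isUnitSMul fun _ => (inv_ne_zero hf).isUnit)).reindex e.symm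
  have hd (i) : d i = ((b.isUnitSMul fun _ => hφ.isUnit).prod
    (c.isUnitSMul fun _ => (inv_ne_zero hf).isUnit)) (e i) := by simp [d]
  refine ⟨d, fun i j => ?_⟩
  rw [hd, hd, warpedForm_apply]
  simp only [← e.apply_eq_iff_eq (x := i)]
  rcases e i with x | x <;> rcases e j with y | y
  · simp only [Basis.prod_apply_inl_fst, Basis.prod_apply_inl_snd, Basis.isUnitSMul_apply,
      map_smul, _root_.smul_apply, smul_eq_mul, hb, map_zero, Sum.inl.injEq, Sum.elim_inl]
    field_simp
    simp
  · simp
  · simp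
  · simp only [Basis.prod_apply_inr_fst, Basis.prod_apply_inr_snd, Basis.isUnitSMul_apply,
      map_smul, _root_.smul_apply, smul_eq_mul, hc, map_zero, Sum.inr.injEq, Sum.elim_inr]
    field_simp
    simp

theorem pseudoEuclideanForm_basisFun (ε : Fin n → ℝ) (i j : Fin n) :
    pseudoEuclideanForm ε ((EuclideanSpace.basisFun (Fin n) ℝ).toBasis i)
      ((EuclideanSpace.basisFun (Fin n) ℝ).toBasis j) = if i = j then ε i else 0 := by
  rw [OrthonormalBasis.coe_toBasis, EuclideanSpace.basisFun_apply, EuclideanSpace.basisFun_apply,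
    pseudoEuclideanForm_single_right]
  by_cases hij : i = j
  · simp [hij]
  · simp [hij, Ne.symm hij]

theorem isSemiRiemannianOn_invariantWarpedMetric [IsManifold (𝓡 m) ∞ F] {ε : Fin n → ℝ}
    (hε : ∀ i, ε i = 1 ∨ ε i = -1) (α : Fin n → ℝ) {J : Set ℝ} {f φ : ℝ → ℝ}
    (hf : ContDiffOn ℝ ∞ f J) (hf0 : ∀ t ∈ J, 0 < f t) (hφ : ContDiffOn ℝ ∞ φ J)
    (hφ0 : ∀ t ∈ J, 0 < φ t) {gF : BilinField (𝓡 m) F} (hgF : IsSemiRiemannianOn (𝓡 m) gF univ)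
    {U : Set (EuclideanSpace ℝ (Fin n) × F)} (hU : ∀ p ∈ U, basicInvariant α p.1 ∈ J) :
    IsSemiRiemannianOn ((𝓡 n).prod (𝓡 m)) (invariantWarpedMetric ε α f φ gF) U := by
  have hε1 : ∀ i, ε i * ε i = 1 := fun i => by rcases hε i with h | h <;> simp [h]
  have hg := invariantWarpedMetric_eq_warpedForm hε1 α f φ gF
  have hU' : ∀ p ∈ U, pseudoEuclideanForm ε (dualVector ε α) p.1 ∈ J := fun p hp => by
    rw [pseudoEuclideanForm_dualVector hε1]
    exact hU p hp
  refine ⟨fun p _ v w => ?_, fun p hp v hv => ?_, ?_, fun p => ?_⟩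
  · have h := warpedForm_comm (pseudoEuclideanForm_comm ε) (pseudoEuclideanForm ε (dualVector ε α))
      f φ (GF := fun _ : EuclideanSpace ℝ (Fin m) => gF p.2) (z := (p.1, 0))
      (fun v w => hgF.symm p.2 (mem_univ _) v w) v w
    exact (hg p v w).trans (h.trans (hg p w v).symm)
  · have h := warpedForm_nondegenerate
      (pseudoEuclideanForm_nondegenerate fun i => left_ne_zero_of_mul_eq_one (hε1 i))
      (l := pseudoEuclideanForm ε (dualVector ε α))
      (GF := fun _ : EuclideanSpace ℝ (Fin m) => gF p.2) (z := (p.1, 0))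
      (hf0 _ (hU' p hp)).ne' (hφ0 _ (hU' p hp)).ne'
      (fun v hv => hgF.nondegenerate p.2 (mem_univ _) v hv) v
    exact h fun w => (hg p v w).symm.trans (hv w)
  · obtain ⟨δ, hδ, hb⟩ := hgF.constant_index
    let e : Fin (finrank ℝ (EuclideanSpace ℝ (Fin n) × EuclideanSpace ℝ (Fin m))) ≃
        Fin n ⊕ Fin (finrank ℝ (EuclideanSpace ℝ (Fin m))) :=
      (finCongr (by rw [finrank_prod, finrank_euclideanSpace_fin])).trans finSumFinEquiv.symm
    have hδ' (x) : Sum.elim ε δ x = 1 ∨ Sum.elim ε δ x = -1 := by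
      rcases x with x | x
      · exact hε x
      · exact hδ x
    refine ⟨fun i => Sum.elim ε δ (e i), fun i => hδ' (e i), fun p hp => ?_⟩
    obtain ⟨c, hc⟩ := hb p.2 (mem_univ _)
    obtain ⟨d, hd⟩ := exists_basis_warpedForm
      (l := pseudoEuclideanForm ε (dualVector ε α)) (f := f) (φ := φ)
      (GF := fun _ : EuclideanSpace ℝ (Fin m) => gF p.2) (z := (p.1, 0)) _
      (pseudoEuclideanForm_basisFun ε) c hc (hf0 _ (hU' p hp)).ne' (hφ0 _ (hU' p hp)).ne' e
    exact ⟨d, fun i j => (hg p (d i) (d j)).trans (hd i j)⟩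
  · refine ((contDiffOn_warpedForm (pseudoEuclideanForm ε)
      (pseudoEuclideanForm ε (dualVector ε α)) (T := (extChartAt (𝓡 m) p.2).target) hf hφ
      (fun t ht => (hφ0 t ht).ne') (by simpa using hgF.smooth p.2)).mono ?_).congr
        fun y hy => inChart_invariantWarpedMetric hε1 α f φ gF p
          (mem_extChartAt_prod_target.1 hy.1)
    rintro y ⟨hy, hyU⟩
    refine ⟨?_, mem_extChartAt_prod_target.1 hy⟩
    have h := hU' _ hyU
    rwa [extChartAt_prod_symm_apply] at h

theorem isQuasiEinsteinOn_invariantWarpedMetric [IsManifold (𝓡 m) ∞ F] {r : ℝ} (hr : r ≠ 0)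
    {ε : Fin n → ℝ} (hε : ∀ i, ε i = 1 ∨ ε i = -1) {α : Fin n → ℝ}
    (hα : ∑ i, ε i * α i ^ 2 = 0) {gF : BilinField (𝓡 m) F}
    (hgF : IsSemiRiemannianOn (𝓡 m) gF univ)
    (hRic : ∀ (q : F) (v w : TangentSpace (𝓡 m) q), ricciTensor (𝓡 m) gF q v w = 0)
    {J : Set ℝ} (hJ : IsOpen J) {f φ h : ℝ → ℝ}
    (hf : ContDiffOn ℝ ∞ f J) (hf0 : ∀ t ∈ J, 0 < f t) (hφ : ContDiffOn ℝ ∞ φ J)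
    (hφ0 : ∀ t ∈ J, 0 < φ t) (hh : DifferentiableOn ℝ h J) (hh' : DifferentiableOn ℝ (deriv h) J)
    (hode : ∀ t ∈ J,
      -r * f t * φ t * deriv (deriv h) t - 2 * r * f t * deriv φ t * deriv h t
        + (((n : ℝ) - 2) * f t * deriv (deriv φ) t - m * φ t * deriv (deriv f) t
            - 2 * m * deriv φ t * deriv f t) * h t = 0) :
    IsQuasiEinsteinOn ((𝓡 n).prod (𝓡 m)) (invariantWarpedMetric ε α f φ gF)
      (fun p : EuclideanSpace ℝ (Fin n) × F => h (basicInvariant α p.1)) r 0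
      {p | basicInvariant α p.1 ∈ J ∧ h (basicInvariant α p.1) ≠ 0} := by
  have hε1 : ∀ i, ε i * ε i = 1 := fun i => by rcases hε i with h | h <;> simp [h]
  have hhs : ContDiffOn ℝ ∞ h J := by
    have hf' := ((contDiffOn_infty_iff_deriv_of_isOpen hJ).1 hf).2
    have hφ' := ((contDiffOn_infty_iff_deriv_of_isOpen hJ).1 hφ).2
    have hf'' := ((contDiffOn_infty_iff_deriv_of_isOpen hJ).1 hf').2
    have hφ'' := ((contDiffOn_infty_iff_deriv_of_isOpen hJ).1 hφ').2
    -- The ODE solved for `h''`, which is possible because `r`, `f` and `φ` do not vanish on `J`.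
    refine contDiffOn_of_linear_ode hJ (a := fun t => -(2 * deriv φ t / φ t))
      (b := fun t => (((n : ℝ) - 2) * f t * deriv (deriv φ) t - m * φ t * deriv (deriv f) t
            - 2 * m * deriv φ t * deriv f t) / (r * f t * φ t)) ?_ ?_ hh hh' fun t ht => ?_
    · exact ((contDiffOn_const.mul hφ').div hφ fun t ht => (hφ0 t ht).ne').neg
    · exact ((((contDiffOn_const.mul hf).mul hφ'').sub ((contDiffOn_const.mul hφ).mul hf'')).sub
        ((contDiffOn_const.mul hφ').mul hf')).div ((contDiffOn_const.mul hf).mul hφ)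
        fun t ht => mul_ne_zero (mul_ne_zero hr (hf0 t ht).ne') (hφ0 t ht).ne'
    · have h1 := (hf0 t ht).ne'
      have h2 := (hφ0 t ht).ne'
      field_simp
      linear_combination -hode t ht
  have hξ : Continuous fun p : EuclideanSpace ℝ (Fin n) × F => basicInvariant α p.1 :=
    (continuous_basicInvariant α).comp continuous_fst
  refine ⟨?_, ?_, ?_, fun p hp => hp.2, fun p hp v w => ?_⟩
  · exact (hh.continuousOn.isOpen_inter_preimage hJ isOpen_compl_singleton).preimage hξ
  · exact isSemiRiemannianOn_invariantWarpedMetric hε α hf hf0 hφ hφ0 hgF fun p hp => hp.1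
  · exact hhs.contMDiffOn.comp
      ((contDiff_basicInvariant α).contMDiff.comp contMDiff_fst).contMDiffOn fun p hp => hp.1
  have hN := isNullWarping_inChart hε1 hα hJ hf hf0 hφ hφ0 hgF p.2
  have hT : (extChartAt (𝓡 m) p.2).target ∈ nhds (extChartAt (𝓡 m) p.2 p.2) :=
    extChartAt_target_mem_nhds p.2
  have hev : inChart ((𝓡 n).prod (𝓡 m)) (invariantWarpedMetric ε α f φ gF) p
      =ᶠ[nhds ((p.1, extChartAt (𝓡 m) p.2 p.2) : EuclideanSpace ℝ (Fin n) × _)]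
      warpedForm (pseudoEuclideanForm ε) (pseudoEuclideanForm ε (dualVector ε α)) f φ
        (inChart (𝓡 m) gF p.2) :=
    Filter.eventually_of_mem (continuousAt_snd.preimage_mem_nhds hT)
      fun y hy => inChart_invariantWarpedMetric hε1 α f φ gF p hy
  have hh_chart : (fun p : EuclideanSpace ℝ (Fin n) × F => h (basicInvariant α p.1)) ∘
      (extChartAt ((𝓡 n).prod (𝓡 m)) p).symm =
      fun z => h (pseudoEuclideanForm ε (dualVector ε α) z.1) := by
    funext z
    rw [Function.comp_apply, extChartAt_prod_symm_apply, pseudoEuclideanForm_dualVector hε1]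
  have hpJ : pseudoEuclideanForm ε (dualVector ε α) p.1 ∈ J := by
    rw [pseudoEuclideanForm_dualVector hε1]
    exact hp.1
  have key (v w : EuclideanSpace ℝ (Fin n) × EuclideanSpace ℝ (Fin m)) :
      localRicci (inChart ((𝓡 n).prod (𝓡 m)) (invariantWarpedMetric ε α f φ gF) p)
          (p.1, extChartAt (𝓡 m) p.2 p.2) v w
        - r / h (basicInvariant α p.1) *
          localHessian (inChart ((𝓡 n).prod (𝓡 m)) (invariantWarpedMetric ε α f φ gF) p)
            (fun z => h (pseudoEuclideanForm ε (dualVector ε α) z.1))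
            (p.1, extChartAt (𝓡 m) p.2 p.2) v w = 0 := by
    rw [localRicci_congr hev, localHessian_congr hev Filter.EventuallyEq.rfl,
      hN.localRicci_eq hpJ (mem_of_mem_nhds hT),
      hN.localHessian_eq hpJ (mem_of_mem_nhds hT) hh hh', localRicci_inChart_eq_zero (hRic p.2),
      finrank_euclideanSpace_fin, finrank_euclideanSpace_fin]
    simp only [pseudoEuclideanForm_dualVector hε1]
    have h1 := (hf0 _ hp.1).ne'
    have h2 := (hφ0 _ hp.1).ne'
    have h3 := hp.2
    field_simp
    -- Both tensors are multiples of `l ⊗ l`; after clearing denominators, the common factor `l(v)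
    -- l(w)` multiplies the ODE.
    linear_combination (basicInvariant α v.1 * basicInvariant α w.1) * hode _ hp.1
  rw [ricciTensor, hessianTensor, hh_chart, extChartAt_prod_apply_self, zero_mul]
  exact key _ _

theorem deriv_exp_mul (c : ℝ) :
    deriv (fun t => Real.exp (c * t)) = fun t => c * Real.exp (c * t) := by
  funext t
  have h := ((hasDerivAt_id t).const_mul c).exp
  simpa [mul_comm] using h.deriv

theorem deriv_deriv_exp_mul (c : ℝ) :
    deriv (deriv fun t => Real.exp (c * t)) = fun t => c ^ 2 * Real.exp (c * t) := by
  funext t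
  rw [deriv_exp_mul, deriv_const_mul_field, deriv_exp_mul]
  ring

end QuasiEinstein

theorem mainTheorem9 (n m : ℕ) (hn : 3 ≤ n) (hm : 1 ≤ m) (r : ℝ) (hr : 0 < r)
    (ε : Fin n → ℝ) (hε : ∀ i, ε i = 1 ∨ ε i = -1)
    (α : Fin n → ℝ) (hα : ∑ i, ε i * α i ^ 2 = 0)
    {F : Type*} [TopologicalSpace F] [ChartedSpace (EuclideanSpace ℝ (Fin m)) F]
    [IsManifold (𝓡 m) ∞ F] (gF : BilinField (𝓡 m) F)
    (hgF : IsSemiRiemannianOn (𝓡 m) gF univ)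
    (hRic : ∀ (q : F) (v w : TangentSpace (𝓡 m) q), ricciTensor (𝓡 m) gF q v w = 0) :
    (∀ (J : Set ℝ) (f φ h : ℝ → ℝ), IsOpen J →
      ContDiffOn ℝ ∞ f J → (∀ t ∈ J, 0 < f t) →
      ContDiffOn ℝ ∞ φ J → (∀ t ∈ J, 0 < φ t) →
      DifferentiableOn ℝ h J → DifferentiableOn ℝ (deriv h) J →
      (∀ t ∈ J,
        -r * f t * φ t * deriv (deriv h) t - 2 * r * f t * deriv φ t * deriv h t
          + (((n : ℝ) - 2) * f t * deriv (deriv φ) t - m * φ t * deriv (deriv f) t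
              - 2 * m * deriv φ t * deriv f t) * h t = 0) →
      IsQuasiEinsteinOn ((𝓡 n).prod (𝓡 m)) (invariantWarpedMetric ε α f φ gF)
        (fun p : EuclideanSpace ℝ (Fin n) × F => h (basicInvariant α p.1)) r 0
        {p | basicInvariant α p.1 ∈ J ∧ h (basicInvariant α p.1) ≠ 0}) ∧
    (α ≠ 0 →
      {s : (ℝ → ℝ) × (ℝ → ℝ) × (ℝ → ℝ) |
        (ContDiff ℝ ∞ s.1 ∧ ContDiff ℝ ∞ s.2.1 ∧ ContDiff ℝ ∞ s.2.2) ∧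
        (∀ t, 0 < s.1 t ∧ 0 < s.2.1 t ∧ 0 < s.2.2 t) ∧
        (s.1 0 = 1 ∧ s.2.1 0 = 1 ∧ s.2.2 0 = 1) ∧
        IsQuasiEinsteinOn ((𝓡 n).prod (𝓡 m)) (invariantWarpedMetric ε α s.1 s.2.1 gF)
          (fun p : EuclideanSpace ℝ (Fin n) × F => s.2.2 (basicInvariant α p.1))
          r 0 univ}.Infinite) := by
  refine ⟨fun J f φ h hJ hf hf0 hφ hφ0 hh hh' hode =>
    isQuasiEinsteinOn_invariantWarpedMetric hr.ne' hε hα hgF hRic hJ hf hf0 hφ hφ0 hh hh' hode,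
    fun _ => ?_⟩
  -- For `f = 1`, `φ = exp(bt)`, `h = exp(cbt)`, the ODE divided by `b² φ h` is this condition on
  -- `c`. Completing the square gives `(c + 1)² = 1 + (n - 2)/r`, which is solvable since the right
  -- side is positive.
  obtain ⟨c, hc⟩ : ∃ c : ℝ, r * c ^ 2 + 2 * r * c = (n : ℝ) - 2 := by
    have hn' : (3 : ℝ) ≤ n := mod_cast hn
    have hs : Real.sqrt (1 + ((n : ℝ) - 2) / r) ^ 2 = 1 + ((n : ℝ) - 2) / r :=
      Real.sq_sqrt (by have := div_nonneg (by linarith : (0 : ℝ) ≤ (n : ℝ) - 2) hr.le; linarith)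
    refine ⟨-1 + Real.sqrt (1 + ((n : ℝ) - 2) / r), ?_⟩
    have hr' : r * (((n : ℝ) - 2) / r) = (n : ℝ) - 2 := mul_div_cancel₀ _ hr.ne'
    linear_combination r * hs + hr'
  have hsmooth (b : ℝ) : ContDiff ℝ ∞ fun t => Real.exp (b * t) := by fun_prop
  -- The same `c` serves every `b`, and the value `φ(1) = exp b` recovers `b`.
  refine infinite_of_injective_forall_mem (f := fun b : ℝ =>
    ((fun _ => 1, fun t => Real.exp (b * t), fun t => Real.exp (c * b * t)) :
      (ℝ → ℝ) × (ℝ → ℝ) × (ℝ → ℝ))) (fun b b' hbb => ?_) fun b => ?_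
  · simpa using congrFun (congrArg (fun s => s.2.1) hbb) 1
  · refine ⟨⟨contDiff_const, hsmooth b, hsmooth _⟩,
      fun t => ⟨one_pos, Real.exp_pos _, Real.exp_pos _⟩, by simp, ?_⟩
    have h := isQuasiEinsteinOn_invariantWarpedMetric hr.ne' hε hα hgF hRic isOpen_univ
      (f := fun _ => 1) (φ := fun t => Real.exp (b * t)) (h := fun t => Real.exp (c * b * t))
      contDiffOn_const (fun _ _ => one_pos) (hsmooth b).contDiffOn (fun _ _ => Real.exp_pos _)
      ((hsmooth _).differentiable (by simp)).differentiableOn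
      (by
        rw [deriv_exp_mul]
        exact (((hsmooth _).differentiable (by simp)).const_mul _).differentiableOn)
      (fun t _ => by
        -- The arrow makes the second-derivative rule fire before the inner derivative is rewritten.
        simp only [↓deriv_deriv_exp_mul, deriv_exp_mul, deriv_const', deriv_const]
        linear_combination -b ^ 2 * Real.exp (b * t) * Real.exp (c * b * t) * hc)
    -- With `J = univ` and `h` never zero, the domain of the general statement is the whole product.
    simpa [Real.exp_ne_zero] using h
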